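/- Let $X$ be a (real) Banach lattice, $T:X\to X$ a linear map (not assumed bounded) and $\varepsilon>0$. Write $\mathbf B(Z)$ for the closed unit ball of a normed space $Z$, and let $|x^*|$ denote the modulus of $x^*$ in the dual Banach lattice $X^*$. Call $T$ *$\varepsilon$-band preserving* ($\varepsilon$-BP) if $\sup\{\|\,|Tx|\wedge y\,\| : y\ge 0,\ y\perp x\}\le\varepsilon\|x\|$ for every $x\in X$, where $y\perp x$ means $|y|\wedge|x|=0$. An ideal of $X$ is a linear subspace $U$, not necessarily closed, such that $y\in U$ whenever $|y|\le|x|$ and $x\in U$. For $\delta>0$, call $T$ *$\delta$-ideal preserving* ($\delta$-IP) if for every ideal $U\subset X$ and every $x\in\mathbf B(X)\cap U$ there exist $y\in U$ and $z\in X$ with $\|z\|\le\delta$ and $Tx=y+z$. Consider the following statements: (1) $T$ is $\varepsilon$-BP. (2) If $x\in\mathbf B(X)$ and $x^*\in\mathbf B(X^*)$ satisfy $\langle|x^*|,|x|\rangle=0$, then $|\langle x^*,Tx\rangle|\le\varepsilon$. (3) For every $\varepsilon'>\varepsilon$, $T$ is $\varepsilon'$-IP. (4) For every $x\in\mathbf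 B(X)$ and every $\varepsilon'>\varepsilon$ there are $\lambda>0$ and $z\in X$ with $\|z\|\le\varepsilon'$ such that $|Tx|\le\lambda|x|+z$. Then $(2)\Leftrightarrow(3)\Leftrightarrow(4)\Rightarrow(1)$. If, in addition, $T$ is bounded, then $(1)\Rightarrow(2)$, so that all four statements are equivalent. -/

import Mathlib

/-!
Real Banach lattices are Mathlib's real normed spaces with a lattice order, a compatible vector
space order, a solid norm (`|x| ≤ |y|` implies `‖x‖ ≤ ‖y‖`) and a complete metric.
-/

namespace BanachLattice

variable {X : Type*} [NormedAddCommGroup X] [Lattice X] [IsOrderedAddMonoid X] [HasSolidNorm X]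
  [NormedSpace ℝ X]

set_option linter.unusedSectionVars false

section DualModulus

/-- The values `f y`, `|y| ≤ a`, whose supremum is the value of the modulus of `f` at `a ≥ 0`. -/
def modulusSet (f : StrongDual ℝ X) (a : X) : Set ℝ :=
  {r | ∃ y : X, |y| ≤ a ∧ f y = r}

/-- The value `sup {f y : |y| ≤ a}` of the modulus of `f` at a positive element `a`. -/
noncomputable def modulusAux (f : StrongDual ℝ X) (a : X) : ℝ :=
  sSup (modulusSet f a)

lemma le_of_mem_modulusSet (f : StrongDual ℝ X) {a : X} {r : ℝ} (hr : r ∈ modulusSet f a) :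
    r ≤ ‖f‖ * ‖a‖ := by
  obtain ⟨y, hy, rfl⟩ := hr
  have h1 : ‖y‖ ≤ ‖a‖ := norm_le_norm_of_abs_le_abs (hy.trans (le_abs_self a))
  calc f y ≤ ‖f y‖ := le_abs_self _
    _ ≤ ‖f‖ * ‖y‖ := f.le_opNorm y
    _ ≤ ‖f‖ * ‖a‖ := by gcongr

lemma bddAbove_modulusSet (f : StrongDual ℝ X) (a : X) : BddAbove (modulusSet f a) :=
  ⟨‖f‖ * ‖a‖, fun _ hr => le_of_mem_modulusSet f hr⟩

lemma zero_mem_modulusSet (f : StrongDual ℝ X) {a : X} (ha : 0 ≤ a) : 0 ∈ modulusSet f a :=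
  ⟨0, by simpa using ha, map_zero f⟩

lemma le_modulusAux (f : StrongDual ℝ X) {a y : X} (hy : |y| ≤ a) : f y ≤ modulusAux f a :=
  le_csSup (bddAbove_modulusSet f a) ⟨y, hy, rfl⟩

lemma modulusAux_le (f : StrongDual ℝ X) {a : X} (ha : 0 ≤ a) {c : ℝ}
    (h : ∀ y : X, |y| ≤ a → f y ≤ c) : modulusAux f a ≤ c :=
  csSup_le ⟨0, zero_mem_modulusSet f ha⟩ (by rintro _ ⟨y, hy, rfl⟩; exact h y hy)

lemma modulusAux_nonneg (f : StrongDual ℝ X) {a : X} (ha : 0 ≤ a) : 0 ≤ modulusAux f a :=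
  le_csSup (bddAbove_modulusSet f a) (zero_mem_modulusSet f ha)

lemma exists_decomposition {a b y : X} (ha : 0 ≤ a) (hb : 0 ≤ b) (hy : |y| ≤ a + b) :
    ∃ u v : X, |u| ≤ a ∧ |v| ≤ b ∧ u + v = y := by
  obtain ⟨h1, h2⟩ := abs_le'.1 hy
  have hu1 : (y ⊓ a) ⊔ (-a) ≤ a := sup_le inf_le_right ((neg_nonpos.2 ha).trans ha)
  have hu2 : -((y ⊓ a) ⊔ (-a)) ≤ a := neg_le.1 le_sup_right
  refine ⟨(y ⊓ a) ⊔ (-a), y - ((y ⊓ a) ⊔ (-a)), abs_le'.2 ⟨hu1, hu2⟩, abs_le'.2 ⟨?_, ?_⟩, by abel⟩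
  · have h3 : y - b ≤ y ⊓ a := le_inf (sub_le_self y hb) (sub_le_iff_le_add.2 h1)
    exact sub_le_comm.1 (h3.trans le_sup_left)
  · rw [neg_sub, sub_le_iff_le_add]
    refine sup_le (inf_le_left.trans (le_add_of_nonneg_left hb)) ?_
    have h4 : -y - b ≤ a := sub_le_iff_le_add.2 h2
    have h5 := neg_le_neg h4
    have h6 : -(-y - b) = b + y := by abel
    rwa [h6] at h5

lemma modulusAux_add (f : StrongDual ℝ X) {a b : X} (ha : 0 ≤ a) (hb : 0 ≤ b) :
    modulusAux f (a + b) = modulusAux f a + modulusAux f b := by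
  apply le_antisymm
  · refine modulusAux_le f (add_nonneg ha hb) fun y hy => ?_
    obtain ⟨u, v, hu, hv, rfl⟩ := exists_decomposition ha hb hy
    rw [map_add]
    exact add_le_add (le_modulusAux f hu) (le_modulusAux f hv)
  · rw [← le_sub_iff_add_le]
    refine modulusAux_le f ha fun u hu => ?_
    rw [le_sub_comm]
    refine modulusAux_le f hb fun v hv => ?_
    rw [le_sub_iff_add_le', ← map_add]
    exact le_modulusAux f ((abs_add_le u v).trans (add_le_add hu hv))

/-- The additive extension of `modulusAux f` from the positive cone to the whole space. -/
noncomputable def modulusHom (f : StrongDual ℝ X) : X →+ ℝ where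
  toFun x := modulusAux f x⁺ - modulusAux f x⁻
  map_zero' := by simp
  map_add' x y := by
    have h : (x + y)⁺ + (x⁻ + y⁻) = (x⁺ + y⁺) + (x + y)⁻ := by
      have h1 := posPart_sub_negPart (x + y)
      have h2 := posPart_sub_negPart x
      have h3 := posPart_sub_negPart y
      have h4 : (x + y)⁺ - (x + y)⁻ = (x⁺ - x⁻) + (y⁺ - y⁻) := by rw [h1, h2, h3]
      rw [sub_add_sub_comm, sub_eq_sub_iff_add_eq_add] at h4
      exact h4
    have h4 := congrArg (modulusAux f) h
    rw [modulusAux_add f (posPart_nonneg _) (add_nonneg (negPart_nonneg _) (negPart_nonneg _)),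
      modulusAux_add f (add_nonneg (posPart_nonneg _) (posPart_nonneg _)) (negPart_nonneg _),
      modulusAux_add f (posPart_nonneg _) (posPart_nonneg _),
      modulusAux_add f (negPart_nonneg _) (negPart_nonneg _)] at h4
    linarith

lemma norm_modulusHom_le (f : StrongDual ℝ X) (x : X) : ‖modulusHom f x‖ ≤ ‖f‖ * ‖x‖ := by
  have hp : x⁺ ≤ |x| := sup_le (le_abs_self x) (abs_nonneg x)
  have hn : x⁻ ≤ |x| := sup_le (neg_le_abs x) (abs_nonneg x)
  have key : ∀ a : X, 0 ≤ a → a ≤ |x| → modulusAux f a ≤ ‖f‖ * ‖x‖ := fun a ha hax =>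
    modulusAux_le f ha fun y hy => by
      have := le_of_mem_modulusSet f (a := |x|) ⟨y, hy.trans hax, rfl⟩
      rwa [norm_abs_eq_norm] at this
  have h1 := key _ (posPart_nonneg x) hp
  have h2 := key _ (negPart_nonneg x) hn
  have h3 := modulusAux_nonneg f (posPart_nonneg x)
  have h4 := modulusAux_nonneg f (negPart_nonneg x)
  change |modulusAux f x⁺ - modulusAux f x⁻| ≤ _
  rw [abs_le]
  constructor <;> linarith

/-- The modulus `|f|` of a functional `f` in the dual of a Banach lattice, given by
`|f|(x) = sup {f y : |y| ≤ x}` for `x ≥ 0` and extended linearly. By `isLeast_dualModulus` it is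
the supremum of `f` and `-f` in the dual Banach lattice. -/
noncomputable def dualModulus (f : StrongDual ℝ X) : StrongDual ℝ X :=
  (modulusHom f).toRealLinearMap
    (AddMonoidHomClass.continuous_of_bound (modulusHom f) ‖f‖ (norm_modulusHom_le f))

/-- The order of the dual Banach lattice: `f ≤ g` if `f x ≤ g x` for all `x ≥ 0`. -/
def DualLE (f g : StrongDual ℝ X) : Prop := ∀ x : X, 0 ≤ x → f x ≤ g x

lemma dualModulus_apply_of_nonneg (f : StrongDual ℝ X) {x : X} (hx : 0 ≤ x) :
    dualModulus f x = sSup {r | ∃ y : X, |y| ≤ x ∧ f y = r} := by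
  have h0 : modulusAux f (0 : X) = 0 := by
    have := modulusAux_add f (le_refl (0 : X)) le_rfl
    rw [add_zero] at this
    linarith
  change modulusAux f x⁺ - modulusAux f x⁻ = modulusAux f x
  rw [posPart_of_nonneg hx, negPart_of_nonneg hx, h0, sub_zero]

/-- `dualModulus f` is the least upper bound of `f` and `-f` in the order of the dual. -/
lemma isLeast_dualModulus (f : StrongDual ℝ X) :
    DualLE f (dualModulus f) ∧ DualLE (-f) (dualModulus f) ∧
      ∀ g : StrongDual ℝ X, DualLE f g → DualLE (-f) g → DualLE (dualModulus f) g := by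
  refine ⟨fun x hx => ?_, fun x hx => ?_, fun g hg hg' x hx => ?_⟩
  · rw [dualModulus_apply_of_nonneg f hx]
    exact le_modulusAux f (abs_of_nonneg hx).le
  · rw [dualModulus_apply_of_nonneg f hx]
    have := le_modulusAux f (a := x) (y := -x) (by rw [abs_neg, abs_of_nonneg hx])
    rw [map_neg] at this
    exact this
  · rw [dualModulus_apply_of_nonneg f hx]
    refine modulusAux_le f hx fun y hy => ?_
    have h1 := hg _ (posPart_nonneg y)
    have h2 := hg' _ (negPart_nonneg y)
    have h3 : f y = f y⁺ - f y⁻ := by rw [← map_sub, posPart_sub_negPart]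
    have h4 : g |y| = g y⁺ + g y⁻ := by rw [← map_add, posPart_add_negPart]
    have h5 : 0 ≤ g (x - |y|) := by
      have h6 := hg _ (sub_nonneg.2 hy)
      have h7 := hg' _ (sub_nonneg.2 hy)
      rw [neg_apply] at h7
      linarith
    rw [map_sub] at h5
    rw [neg_apply] at h2
    linarith

end DualModulus

/-- Disjointness `x ⊥ y` of elements of a vector lattice. -/
def Disj (x y : X) : Prop := |x| ⊓ |y| = 0

/-- The numbers `‖|Tx| ∧ y‖` with `y ≥ 0` and `y ⊥ x`. -/
def bpSet (T : X →ₗ[ℝ] X) (x : X) : Set ℝ :=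
  {r | ∃ y : X, 0 ≤ y ∧ Disj y x ∧ ‖|T x| ⊓ y‖ = r}

/-- `T` is `ε`-band preserving. The supremum is that of a nonempty set bounded by `‖T x‖`, see
`bpSet_nonempty` and `bddAbove_bpSet`. -/
def IsBandPreserving (ε : ℝ) (T : X →ₗ[ℝ] X) : Prop :=
  ∀ x : X, sSup (bpSet T x) ≤ ε * ‖x‖

lemma bpSet_nonempty (T : X →ₗ[ℝ] X) (x : X) : (bpSet T x).Nonempty :=
  ⟨_, 0, le_rfl, by simp [Disj], rfl⟩

lemma bddAbove_bpSet (T : X →ₗ[ℝ] X) (x : X) : BddAbove (bpSet T x) := by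
  refine ⟨‖T x‖, ?_⟩
  rintro _ ⟨y, hy, -, rfl⟩
  apply norm_le_norm_of_abs_le_abs
  rw [abs_of_nonneg (le_inf (abs_nonneg _) hy)]
  exact inf_le_left

/-- A (not necessarily closed) order ideal: a linear subspace `U` such that `|y| ≤ |x|` and
`x ∈ U` imply `y ∈ U`. -/
def IsIdeal (U : Submodule ℝ X) : Prop :=
  LatticeOrderedAddCommGroup.IsSolid (U : Set X)

/-- `T` is `ε`-ideal preserving: for every ideal `U` and every `x ∈ U` with `‖x‖ ≤ 1`, one can
write `Tx = y + z` with `y ∈ U` and `‖z‖ ≤ ε`. -/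
def IsIdealPreserving (ε : ℝ) (T : X →ₗ[ℝ] X) : Prop :=
  ∀ U : Submodule ℝ X, IsIdeal U → ∀ x ∈ U, ‖x‖ ≤ 1 →
    ∃ y ∈ U, ∃ z : X, ‖z‖ ≤ ε ∧ T x = y + z

/-- The duality condition: `|⟨f, Tx⟩| ≤ ε` for `x` and `f` in the closed unit balls of `X` and of
its dual with `⟨|f|, |x|⟩ = 0`. -/
def DualityCondition (ε : ℝ) (T : X →ₗ[ℝ] X) : Prop :=
  ∀ (x : X) (f : StrongDual ℝ X), ‖x‖ ≤ 1 → ‖f‖ ≤ 1 → dualModulus f |x| = 0 → |f (T x)| ≤ ε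

/-- The domination condition: for `‖x‖ ≤ 1` and `ε' > ε` there are `λ > 0` and `z` with
`‖z‖ ≤ ε'` and `|Tx| ≤ λ|x| + z`. -/
def DominationCondition (ε : ℝ) (T : X →ₗ[ℝ] X) : Prop :=
  ∀ x : X, ‖x‖ ≤ 1 → ∀ ε' : ℝ, ε < ε' →
    ∃ l : ℝ, 0 < l ∧ ∃ z : X, ‖z‖ ≤ ε' ∧ |T x| ≤ l • |x| + z

end BanachLattice

namespace BanachLattice

set_option linter.unusedSectionVars false

section

variable {X : Type*} [NormedAddCommGroup X] [Lattice X] [IsOrderedAddMonoid X] [HasSolidNorm X]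
  [NormedSpace ℝ X] [IsOrderedModule ℝ X]

/-! The duality, ideal and domination conditions all say that, for `‖x‖ ≤ 1`, `T x` lies within
every `ε' > ε` of the principal ideal of `x`. Domination becomes ideal approximation by Riesz
decomposition. The functionals with `|f|(|x|) = 0` are exactly those annihilating that ideal, so
Hahn–Banach in the quotient gives the duality form. Domination implies band preservation because a
`y ⊥ x` does not see `l|x|`. For the converse with `T` bounded, truncate `x` at height `d|Tx|`. The
truncation `c` is small, hence so is `T c`, while `x - c` is disjoint from `y = (|Tx| - d⁻¹|x|)⁺`.
Since `y ≤ |Tx|`, band preservation at `x - c` makes `‖y‖` at most `ε + ‖T c‖`, and `|Tx| ≤ d⁻¹|x| +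
y`. -/

lemma abs_smul_le_smul_abs (c : ℝ) (x : X) : |c • x| ≤ |c| • |x| := by
  refine abs_le'.2 ?_
  rcases le_total 0 c with hc | hc
  · rw [abs_of_nonneg hc, ← smul_neg]
    exact ⟨smul_le_smul_of_nonneg_left (le_abs_self x) hc,
      smul_le_smul_of_nonneg_left (neg_le_abs x) hc⟩
  · rw [abs_of_nonpos hc]
    refine ⟨?_, ?_⟩
    · rw [← neg_smul_neg]
      exact smul_le_smul_of_nonneg_left (neg_le_abs x) (neg_nonneg.2 hc)
    · rw [← neg_smul]
      exact smul_le_smul_of_nonneg_left (le_abs_self x) (neg_nonneg.2 hc)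

/-- With `M = max 1 c`, the meet lies below both `M u` and `M v`, so dividing by `M` puts it below
`u ⊓ v`. -/
lemma inf_smul_eq_zero {u v : X} (hu : 0 ≤ u) (hv : 0 ≤ v) (h : u ⊓ v = 0) {c : ℝ} (hc : 0 ≤ c) :
    u ⊓ c • v = 0 := by
  refine le_antisymm ?_ (le_inf hu (smul_nonneg hc hv))
  have hM : 0 < max 1 c := lt_max_of_lt_left one_pos
  have h1 : u ⊓ c • v ≤ max 1 c • u :=
    inf_le_left.trans (by simpa using smul_le_smul_of_nonneg_right (le_max_left 1 c) hu)
  have h2 : u ⊓ c • v ≤ max 1 c • v :=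
    inf_le_right.trans (smul_le_smul_of_nonneg_right (le_max_right 1 c) hv)
  have h3 : (max 1 c)⁻¹ • (u ⊓ c • v) ≤ 0 := by
    rw [← h]
    exact le_inf ((inv_smul_le_iff_of_pos hM).2 h1) ((inv_smul_le_iff_of_pos hM).2 h2)
  simpa using (inv_smul_le_iff_of_pos hM).1 h3

/-- The ideal generated by `x`, i.e. all `y` with `|y| ≤ l |x|` for some `l ≥ 0`. -/
def principalIdeal (x : X) : Submodule ℝ X where
  carrier := {y | ∃ l : ℝ, 0 ≤ l ∧ |y| ≤ l • |x|}
  zero_mem' := ⟨0, le_rfl, by simp⟩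
  add_mem' := by
    rintro a b ⟨l, hl, ha⟩ ⟨m, hm, hb⟩
    exact ⟨l + m, add_nonneg hl hm,
      (abs_add_le a b).trans ((add_le_add ha hb).trans (add_smul l m |x|).ge)⟩
  smul_mem' := by
    rintro c a ⟨l, hl, ha⟩
    refine ⟨|c| * l, mul_nonneg (abs_nonneg c) hl, (abs_smul_le_smul_abs c a).trans ?_⟩
    rw [mul_smul]
    exact smul_le_smul_of_nonneg_left ha (abs_nonneg c)

lemma isIdeal_principalIdeal (x : X) : IsIdeal (principalIdeal x) := by
  rintro a ⟨l, hl, ha⟩ b hb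
  exact ⟨l, hl, hb.trans ha⟩

lemma self_mem_principalIdeal (x : X) : x ∈ principalIdeal x :=
  ⟨1, zero_le_one, by simp⟩

lemma IsIdeal.mem_of_abs_le_smul {U : Submodule ℝ X} (hU : IsIdeal U) {x y : X} (hx : x ∈ U)
    {l : ℝ} (h : |y| ≤ l • |x|) : y ∈ U := by
  have h1 : |x| ∈ U := hU hx (abs_abs x).le
  exact hU (U.smul_mem l h1) (h.trans (le_abs_self _))

/-- A functional whose modulus vanishes at `|x|` vanishes on the ideal generated by `x`. -/
lemma apply_eq_zero_of_mem_principalIdeal {f : StrongDual ℝ X} {x y : X}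
    (hf : dualModulus f |x| = 0) (hy : y ∈ principalIdeal x) : f y = 0 := by
  obtain ⟨l, hl, h⟩ := hy
  have key : ∀ w : X, |w| ≤ l • |x| → f w ≤ 0 := fun w hw => by
    have h0 : dualModulus f (l • |x|) = 0 := by rw [map_smul, hf, smul_zero]
    rw [dualModulus_apply_of_nonneg f (smul_nonneg hl (abs_nonneg x))] at h0
    exact (le_modulusAux f hw).trans h0.le
  refine le_antisymm (key y h) ?_
  simpa using key (-y) (by rwa [abs_neg])

lemma dualModulus_abs_eq_zero {f : StrongDual ℝ X} {x : X}
    (hf : ∀ y ∈ principalIdeal x, f y = 0) : dualModulus f |x| = 0 := by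
  rw [dualModulus_apply_of_nonneg f (abs_nonneg x)]
  refine le_antisymm (modulusAux_le f (abs_nonneg x) fun y hy => ?_)
    (modulusAux_nonneg f (abs_nonneg x))
  exact (hf y ⟨1, zero_le_one, by rwa [one_smul]⟩).le

/-- If every functional of norm at most one that vanishes on `U` is at most `ε` at `w`, then `w` is within
`ε'` of `U` for every `ε' > ε`. -/
lemma exists_mem_norm_sub_lt {E : Type*} [NormedAddCommGroup E] [NormedSpace ℝ E]
    (U : Submodule ℝ E) (w : E) {ε ε' : ℝ} (hε : ε < ε')
    (h : ∀ f : StrongDual ℝ E, ‖f‖ ≤ 1 → (∀ y ∈ U, f y = 0) → |f w| ≤ ε) :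
    ∃ y ∈ U, ‖w - y‖ < ε' := by
  -- `U` need not be closed, so the quotient is only seminormed; a functional norming the class of
  -- `w` pulls back to one vanishing on `U`.
  obtain ⟨g, hg, hgw⟩ := exists_dual_vector'' ℝ (U.mkQ w)
  let f : StrongDual ℝ E := LinearMap.mkContinuous (g.toLinearMap.comp U.mkQ) 1 fun x => by
    rw [one_mul]
    calc ‖g (U.mkQ x)‖ ≤ ‖g‖ * ‖U.mkQ x‖ := g.le_opNorm _
      _ ≤ 1 * ‖U.mkQ x‖ := by gcongr
      _ = ‖U.mkQ x‖ := one_mul _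
      _ ≤ ‖x‖ := Submodule.Quotient.norm_mk_le U x
  have hfw : f w = ‖U.mkQ w‖ := hgw
  have h1 : |f w| ≤ ε := h f (LinearMap.mkContinuous_norm_le _ zero_le_one _) fun y hy => by
    have h2 : U.mkQ y = 0 := (Submodule.Quotient.mk_eq_zero U).2 hy
    change g (U.mkQ y) = 0
    rw [h2, map_zero]
  have h3 : ‖U.mkQ w‖ < ε' := by
    rw [hfw, abs_of_nonneg (norm_nonneg _)] at h1
    exact h1.trans_lt hε
  obtain ⟨m, hm, hlt⟩ := (QuotientAddGroup.norm_lt_iff (S := U.toAddSubgroup)).1 h3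
  refine ⟨w - m, ?_, by simpa using hlt⟩
  exact (Submodule.Quotient.eq U).1 hm.symm

/-! ### Ideal preservation, duality and domination -/

variable {ε : ℝ} {T : X →ₗ[ℝ] X}

lemma le_smul_abs_add_abs {x y z : X} {l : ℝ} (hy : |y| ≤ l • |x|) :
    |y + z| ≤ (|l| + 1) • |x| + |z| := by
  have h : l • |x| ≤ (|l| + 1) • |x| :=
    smul_le_smul_of_nonneg_right ((le_abs_self l).trans (by linarith)) (abs_nonneg x)
  exact (abs_add_le y z).trans (by gcongr; exact hy.trans h)

lemma DominationCondition.isIdealPreserving (h : DominationCondition ε T) {ε' : ℝ}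
    (hε : ε < ε') : IsIdealPreserving ε' T := by
  intro U hU x hx hx1
  obtain ⟨l, hl, z, hz, hT⟩ := h x hx1 ε' hε
  -- Riesz decomposition: `T x` splits into a part dominated by `l|x|`, hence in `U`, and a part
  -- dominated by `|z|`.
  obtain ⟨u, v, hu, hv, huv⟩ := exists_decomposition (smul_nonneg hl.le (abs_nonneg x))
    (abs_nonneg z) (hT.trans (by gcongr; exact le_abs_self z))
  exact ⟨u, hU.mem_of_abs_le_smul hx hu, v, (norm_le_norm_of_abs_le_abs hv).trans hz, huv.symm⟩

lemma dominationCondition_of_isIdealPreserving (h : ∀ ε', ε < ε' → IsIdealPreserving ε' T) :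
    DominationCondition ε T := by
  intro x hx ε' hε
  obtain ⟨y, ⟨l, -, hy⟩, z, hz, hT⟩ :=
    h ε' hε _ (isIdeal_principalIdeal x) x (self_mem_principalIdeal x) hx
  refine ⟨|l| + 1, by positivity, |z|, by rwa [norm_abs_eq_norm], ?_⟩
  rw [hT]
  exact le_smul_abs_add_abs hy

lemma dualityCondition_of_isIdealPreserving (h : ∀ ε', ε < ε' → IsIdealPreserving ε' T) :
    DualityCondition ε T := by
  intro x f hx hf hfx
  refine le_of_forall_gt_imp_ge_of_dense fun ε' hε => ?_
  obtain ⟨y, hy, z, hz, hT⟩ :=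
    h ε' hε _ (isIdeal_principalIdeal x) x (self_mem_principalIdeal x) hx
  rw [hT, map_add, apply_eq_zero_of_mem_principalIdeal hfx hy, zero_add]
  calc |f z| ≤ ‖f‖ * ‖z‖ := f.le_opNorm z
    _ ≤ 1 * ‖z‖ := by gcongr
    _ ≤ ε' := by rwa [one_mul]

lemma DualityCondition.dominationCondition (h : DualityCondition ε T) :
    DominationCondition ε T := by
  intro x hx ε' hε
  obtain ⟨y, ⟨l, -, hy⟩, hlt⟩ := exists_mem_norm_sub_lt (principalIdeal x) (T x) hε
    fun f hf hfx => h x f hx hf (dualModulus_abs_eq_zero hfx)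
  refine ⟨|l| + 1, by positivity, |T x - y|, by rw [norm_abs_eq_norm]; exact hlt.le, ?_⟩
  simpa using le_smul_abs_add_abs (z := T x - y) hy

lemma DominationCondition.exists_le_smul_add (h : DominationCondition ε T) (x : X) {ε' : ℝ}
    (hε : ε < ε') :
    ∃ l : ℝ, 0 < l ∧ ∃ z : X, ‖z‖ ≤ ε' * ‖x‖ ∧ |T x| ≤ l • |x| + z := by
  rcases eq_or_ne x 0 with rfl | hx
  · exact ⟨1, one_pos, 0, by simp, by simp⟩
  have hx0 : 0 < ‖x‖ := norm_pos_iff.2 hx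
  obtain ⟨l, hl, z, hz, hT⟩ := h (‖x‖⁻¹ • x) (by simp [norm_smul, hx0.ne']) ε' hε
  refine ⟨l, hl, ‖x‖ • z, ?_, ?_⟩
  · rw [norm_smul, norm_norm, mul_comm]
    gcongr
  · have h1 : |‖x‖⁻¹ • x| ≤ ‖x‖⁻¹ • |x| := by
      simpa using abs_smul_le_smul_abs ‖x‖⁻¹ x
    calc |T x| = |‖x‖ • T (‖x‖⁻¹ • x)| := by rw [map_smul, smul_inv_smul₀ hx0.ne']
      _ ≤ ‖x‖ • |T (‖x‖⁻¹ • x)| := by simpa using abs_smul_le_smul_abs ‖x‖ (T (‖x‖⁻¹ • x))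
      _ ≤ ‖x‖ • (l • (‖x‖⁻¹ • |x|) + z) := by
        refine smul_le_smul_of_nonneg_left (hT.trans ?_) hx0.le
        gcongr
      _ = l • |x| + ‖x‖ • z := by
        rw [smul_add, smul_comm l, smul_inv_smul₀ hx0.ne']

lemma DominationCondition.isBandPreserving (h : DominationCondition ε T) :
    IsBandPreserving ε T := by
  intro x
  refine csSup_le (bpSet_nonempty T x) ?_
  rintro _ ⟨y, hy, hyx, rfl⟩
  have key : ∀ ε', ε < ε' → ‖|T x| ⊓ y‖ ≤ ε' * ‖x‖ := fun ε' hε => by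
    obtain ⟨l, hl, z, hz, hT⟩ := h.exists_le_smul_add x hε
    refine (norm_le_norm_of_abs_le_abs ?_).trans hz
    have h0 : 0 ≤ |T x| ⊓ y := le_inf (abs_nonneg _) hy
    rw [abs_of_nonneg h0]
    have hd : y ⊓ l • |x| = 0 := by
      rw [Disj, abs_of_nonneg hy] at hyx
      exact inf_smul_eq_zero hy (abs_nonneg x) hyx hl.le
    -- Subtracting `|z|` leaves an element below two disjoint ones, hence below `0`.
    have h1 : |T x| ⊓ y - |z| ≤ y ⊓ l • |x| := by
      refine le_inf ((sub_le_self _ (abs_nonneg z)).trans inf_le_right) ?_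
      rw [sub_le_iff_le_add]
      exact inf_le_left.trans (hT.trans (by gcongr; exact le_abs_self z))
    rwa [hd, sub_nonpos] at h1
  have ht : Filter.Tendsto (fun ε' : ℝ => ε' * ‖x‖) (nhdsWithin ε (Set.Ioi ε))
      (nhds (ε * ‖x‖)) :=
    ((continuous_id.mul continuous_const).tendsto ε).mono_left nhdsWithin_le_nhds
  exact ge_of_tendsto ht (Filter.eventually_of_mem self_mem_nhdsWithin key)

/-! ### Truncation, and domination from band preservation -/

lemma abs_sub_clip_le (a x : X) :
    |x - (x ⊓ a ⊔ -a)| ≤ (|x| - a)⁺ := by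
  refine abs_le'.2 ⟨?_, ?_⟩
  · rw [sub_le_comm]
    refine le_trans ?_ le_sup_left
    refine le_inf (sub_le_self x (posPart_nonneg _)) ?_
    rw [sub_le_comm]
    exact (sub_le_sub_right (le_abs_self x) a).trans (le_posPart _)
  · rw [neg_sub, sub_le_iff_le_add]
    refine sup_le (inf_le_left.trans (le_add_of_nonneg_left (posPart_nonneg _))) ?_
    rw [← sub_le_iff_le_add]
    refine le_trans ?_ (le_posPart _)
    rw [show -a - x = -x - a by abel]
    exact sub_le_sub_right (neg_le_abs x) a

lemma abs_clip_le {a : X} (ha : 0 ≤ a) (x : X) : |x ⊓ a ⊔ -a| ≤ a :=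
  abs_le'.2 ⟨sup_le inf_le_right ((neg_nonpos.2 ha).trans ha), neg_le.1 le_sup_right⟩

lemma IsBandPreserving.dominationCondition (h : IsBandPreserving ε T) (hε : 0 < ε)
    (hT : ∃ C : ℝ, ∀ x : X, ‖T x‖ ≤ C * ‖x‖) : DominationCondition ε T := by
  intro x hx ε' hε'
  obtain ⟨C, hC⟩ := hT
  set w := T x with hw
  -- The truncation satisfies `|c| ≤ d|w|`, so this `d` forces `‖T c‖ ≤ ε' - ε`; the `+ 1` keeps the
  -- denominator positive.
  obtain ⟨d, hd, hdC⟩ : ∃ d : ℝ, 0 < d ∧ |C| * (d * ‖w‖) ≤ ε' - ε := by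
    have hpos : 0 < |C| * ‖w‖ + 1 := by positivity
    refine ⟨(ε' - ε) / (|C| * ‖w‖ + 1), div_pos (sub_pos.2 hε') hpos, ?_⟩
    rw [← mul_assoc, mul_comm |C|, mul_assoc, div_mul_eq_mul_div, div_le_iff₀ hpos]
    exact mul_le_mul_of_nonneg_left (by linarith) (sub_pos.2 hε').le
  set a := d • |w| with ha_def
  have ha : 0 ≤ a := smul_nonneg hd.le (abs_nonneg w)
  set c := x ⊓ a ⊔ -a with hc_def
  -- This is `(|w| - d⁻¹|x|)⁺`, the excess of `|w|` over `d⁻¹|x|`.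
  set y := d⁻¹ • (a - |x|)⁺ with hy_def
  have hd' : 0 ≤ d⁻¹ := (inv_pos.2 hd).le
  have hy0 : 0 ≤ y := smul_nonneg hd' (posPart_nonneg _)
  have hwy : |w| ⊓ y = y := by
    refine inf_eq_right.2 ((inv_smul_le_iff_of_pos hd).2 ?_)
    exact sup_le (sub_le_self a (abs_nonneg x)) ha
  have hdisj : Disj y (x - c) := by
    have h1 : (|x| - a)⁺ ⊓ y = 0 := by
      refine inf_smul_eq_zero (posPart_nonneg _) (posPart_nonneg _) ?_ hd'
      have h2 := posPart_inf_negPart_eq_zero (|x| - a)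
      rwa [← posPart_neg, neg_sub] at h2
    refine le_antisymm ?_ (le_inf (abs_nonneg _) (abs_nonneg _))
    rw [abs_of_nonneg hy0, ← h1, inf_comm]
    exact inf_le_inf_right y (abs_sub_clip_le a x)
  have hxc : ‖x - c‖ ≤ 1 := by
    refine (norm_le_norm_of_abs_le_abs ((abs_sub_clip_le a x).trans ?_)).trans hx
    exact sup_le (sub_le_self _ ha) (abs_nonneg x)
  have hTc : ‖T c‖ ≤ ε' - ε := by
    have h1 : ‖c‖ ≤ d * ‖w‖ := by
      have h2 : ‖c‖ ≤ ‖a‖ :=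
        norm_le_norm_of_abs_le_abs ((abs_clip_le ha x).trans (le_abs_self a))
      rwa [ha_def, norm_smul, norm_abs_eq_norm, Real.norm_of_nonneg hd.le] at h2
    calc ‖T c‖ ≤ C * ‖c‖ := hC c
      _ ≤ |C| * (d * ‖w‖) := by
        gcongr
        exact le_abs_self C
      _ ≤ ε' - ε := hdC
  have hband : ‖|T (x - c)| ⊓ y‖ ≤ ε := by
    have h1 := (le_csSup (bddAbove_bpSet T (x - c)) ⟨y, hy0, hdisj, rfl⟩).trans (h (x - c))
    exact h1.trans (mul_le_of_le_one_right hε.le hxc)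
  have hy : ‖y‖ ≤ ε' := by
    -- Meeting with a fixed `y` is nonexpansive, so replacing `w` by `T (x - c)` costs at most `‖T
    -- c‖`.
    have h1 : ‖|w| ⊓ y - |T (x - c)| ⊓ y‖ ≤ ‖T c‖ := by
      refine (norm_inf_sub_inf_le_add_norm _ _ _ _).trans ?_
      rw [sub_self, norm_zero, add_zero]
      refine norm_le_norm_of_abs_le_abs ((abs_abs_sub_abs_le _ _).trans_eq ?_)
      rw [map_sub, ← hw, sub_sub_cancel]
    rw [hwy] at h1
    have h2 := norm_le_insert' y (|T (x - c)| ⊓ y)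
    linarith
  refine ⟨d⁻¹, inv_pos.2 hd, y, hy, ?_⟩
  rw [hy_def, ← smul_add, le_inv_smul_iff_of_pos hd, ← sub_le_iff_le_add']
  exact le_posPart _

end

end BanachLattice

open BanachLattice in
theorem theorem2p7 {X : Type*} [NormedAddCommGroup X] [Lattice X] [IsOrderedAddMonoid X]
    [HasSolidNorm X] [NormedSpace ℝ X] [IsOrderedModule ℝ X] [CompleteSpace X]
    (T : X →ₗ[ℝ] X) (ε : ℝ) (hε : 0 < ε) :
    (BanachLattice.DualityCondition ε T ↔
      ∀ ε' : ℝ, ε < ε' → BanachLattice.IsIdealPreserving ε' T) ∧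
    ((∀ ε' : ℝ, ε < ε' → BanachLattice.IsIdealPreserving ε' T) ↔
      BanachLattice.DominationCondition ε T) ∧
    (BanachLattice.DominationCondition ε T → BanachLattice.IsBandPreserving ε T) ∧
    ((∃ C : ℝ, ∀ x : X, ‖T x‖ ≤ C * ‖x‖) →
      List.TFAE [BanachLattice.IsBandPreserving ε T,
        BanachLattice.DualityCondition ε T,
        ∀ ε' : ℝ, ε < ε' → BanachLattice.IsIdealPreserving ε' T,
        BanachLattice.DominationCondition ε T]) := by
  have h23 : DualityCondition ε T ↔ ∀ ε' : ℝ, ε < ε' → IsIdealPreserving ε' T :=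
    ⟨fun h _ hε' => h.dominationCondition.isIdealPreserving hε',
      dualityCondition_of_isIdealPreserving⟩
  have h34 : (∀ ε' : ℝ, ε < ε' → IsIdealPreserving ε' T) ↔ DominationCondition ε T :=
    ⟨dominationCondition_of_isIdealPreserving, fun h _ hε' => h.isIdealPreserving hε'⟩
  refine ⟨h23, h34, fun h => h.isBandPreserving, fun hT => ?_⟩
  tfae_have 1 → 4 := fun h => h.dominationCondition hε hT
  tfae_have 4 → 1 := fun h => h.isBandPreserving
  tfae_have 2 ↔ 3 := h23
  tfae_have 3 ↔ 4 := h34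
  tfae_finish
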